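/- Let $\Gamma$ be a (non-empty, simple, undirected) locally finite vertex-transitive graph, that is, every vertex has finitely many neighbours and the automorphism group of $\Gamma$ acts transitively on the vertices. For $n\in\mathbb{N}$ write $\beta_\Gamma(n)$ for the number of vertices in a ball of radius $n$ in $\Gamma$, i.e. the number of vertices at graph distance at most $n$ from a given vertex $o$; by vertex-transitivity this does not depend on $o$. Let $K\ge 1$ be a real number and suppose that $$\beta_\Gamma(2n)\le K\,\beta_\Gamma(n)$$ for some integer $n\ge 8K^4$. Then, for this $n$, $$\beta_\Gamma(3n)\le \left(2^{12}K^{24}\right)^{10\cdot 5^{4K^4}}\beta_\Gamma(n).$$ -/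

import Mathlib

namespace SimpleGraph

/-- A graph is vertex-transitive if its automorphism group acts transitively on the vertices. -/
def IsVertexTransitive {V : Type*} (G : SimpleGraph V) : Prop :=
  ∀ u v : V, ∃ φ : G ≃g G, φ u = v

/-- The ball of radius `n` about `o`: all vertices at graph distance at most `n` from `o`.
The extended distance is used, so vertices in other components are never in the ball. -/
def distBall {V : Type*} (G : SimpleGraph V) (o : V) (n : ℕ) : Set V :=
  {v | G.edist o v ≤ (n : ℕ∞)}

/-- The number of vertices in the ball of radius `n` about `o`. -/
noncomputable def ballVolume {V : Type*} (G : SimpleGraph V) (o : V) (n : ℕ) : ℕ :=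
  (G.distBall o n).ncard

/-- In a locally finite graph balls are finite, so `ballVolume` is a genuine count. -/
theorem distBall_finite {V : Type*} (G : SimpleGraph V) [G.LocallyFinite] (o : V) (n : ℕ) :
    (G.distBall o n).Finite := by
  induction n generalizing o with
  | zero =>
    refine (Set.finite_singleton o).subset fun v hv => ?_
    simpa [distBall] using hv
  | succ n ih =>
    refine ((Set.finite_singleton o).union
      (Set.Finite.biUnion (G.neighborSet o).toFinite fun w _ => ih w)).subset fun v hv => ?_
    have hv' : G.edist o v ≤ ((n + 1 : ℕ) : ℕ∞) := hv
    have hne : G.edist o v ≠ ⊤ := fun h => by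
      rw [h, top_le_iff] at hv'
      exact ENat.natCast_ne_top _ hv'
    obtain ⟨p, hp⟩ := G.exists_walk_of_edist_ne_top hne
    rw [← hp] at hv'
    cases p with
    | nil => exact Or.inl rfl
    | @cons _ w _ h q =>
      refine Or.inr (Set.mem_biUnion (x := w) h ?_)
      refine (G.edist_le q).trans ?_
      have : q.length + 1 ≤ n + 1 := by exact_mod_cast hv'
      exact_mod_cast Nat.le_of_succ_le_succ this

/-- Automorphisms do not increase extended distances. -/
theorem edist_map_le {V : Type*} (G : SimpleGraph V) (φ : G ≃g G) (u v : V) :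
    G.edist (φ u) (φ v) ≤ G.edist u v := by
  by_cases h : G.edist u v = ⊤
  · rw [h]
    exact le_top
  · obtain ⟨p, hp⟩ := G.exists_walk_of_edist_ne_top h
    rw [← hp]
    have := G.edist_le (p.map φ.toHom)
    rwa [Walk.length_map] at this

/-- In a vertex-transitive graph the volume of a ball does not depend on its centre. -/
theorem IsVertexTransitive.ballVolume_eq {V : Type*} {G : SimpleGraph V}
    (hG : G.IsVertexTransitive) (o o' : V) (n : ℕ) : G.ballVolume o n = G.ballVolume o' n := by
  obtain ⟨φ, rfl⟩ := hG o o'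
  have h : φ '' G.distBall o n = G.distBall (φ o) n := by
    ext v
    constructor
    · rintro ⟨u, hu, rfl⟩
      exact (G.edist_map_le φ o u).trans hu
    · intro hv
      refine ⟨φ.symm v, ?_, φ.apply_symm_apply v⟩
      have h1 := G.edist_map_le φ.symm (φ o) v
      rw [φ.symm_apply_apply] at h1
      exact h1.trans hv
  unfold ballVolume
  rw [← h, Set.ncard_image_of_injective _ φ.injective]

end SimpleGraph

/-! Write β for the volume of an `n`-ball, c = β/(2K), and let F join two vertices whose `n`-balls
share at least c vertices. By Cauchy–Schwarz, doubling allows at most 2K pairwise non-adjacent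
points of F in B(o, n) (`card_le_of_inter_lt`), so some net of at most 2K points covers B(o, n) at
an F-scale m = 5^j and is 5m-separated. The net points used by B(o, k) stabilise for some k < 2K, so
B(o, n) lies within F-distance 2m of the much smaller B(o, k) (`exists_small_radius`). Translating
and iterating puts B(o, 3n) within F-distance M = 10m of B(o, n). Counting walks with jumps of
length at most 2n then gives β(3n) c^M ≤ (Kβ)^(M+1) (`card_mul_pow_le`). -/

namespace SimpleGraph

section Balls

variable {V : Type*} (G : SimpleGraph V)

theorem self_mem_distBall (o : V) (n : ℕ) : o ∈ G.distBall o n := by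
  simp [distBall]

variable {G}

theorem mem_distBall_comm {u v : V} {n : ℕ} : u ∈ G.distBall v n ↔ v ∈ G.distBall u n := by
  simp [distBall, edist_comm]

theorem mem_distBall_add {u v w : V} {a b : ℕ} (h₁ : v ∈ G.distBall u a)
    (h₂ : w ∈ G.distBall v b) : w ∈ G.distBall u (a + b) := by
  simp only [distBall, Set.mem_ofPred_eq, Nat.cast_add] at *
  exact G.edist_triangle.trans (add_le_add h₁ h₂)

theorem distBall_mono (o : V) {a b : ℕ} (h : a ≤ b) : G.distBall o a ⊆ G.distBall o b :=
  fun v hv => le_trans (show G.edist o v ≤ a from hv) (by exact_mod_cast h)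

theorem mem_distBall_iff_exists_walk {u v : V} {n : ℕ} :
    v ∈ G.distBall u n ↔ ∃ p : G.Walk u v, p.length ≤ n := by
  constructor
  · intro hv
    have hne : G.edist u v ≠ ⊤ := ne_top_of_le_ne_top (ENat.natCast_ne_top n) hv
    obtain ⟨p, hp⟩ := G.exists_walk_of_edist_ne_top hne
    refine ⟨p, ?_⟩
    have hv' : G.edist u v ≤ n := hv
    rw [← hp] at hv'
    exact_mod_cast hv'
  · rintro ⟨p, hp⟩
    exact (G.edist_le p).trans (by exact_mod_cast hp)

theorem exists_mem_distBall_of_add {u w : V} {a b : ℕ} (h : w ∈ G.distBall u (a + b)) :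
    ∃ v ∈ G.distBall u a, w ∈ G.distBall v b := by
  obtain ⟨p, hp⟩ := mem_distBall_iff_exists_walk.1 h
  refine ⟨p.getVert a, mem_distBall_iff_exists_walk.2 ⟨p.take a, ?_⟩,
    mem_distBall_iff_exists_walk.2 ⟨p.drop a, ?_⟩⟩
  · rw [Walk.take_length]
    exact min_le_left _ _
  · rw [Walk.drop_length]
    omega

theorem map_mem_distBall_iff (φ : G ≃g G) {u v : V} {n : ℕ} :
    φ v ∈ G.distBall (φ u) n ↔ v ∈ G.distBall u n := by
  refine ⟨fun h => ?_, fun h => (G.edist_map_le φ u v).trans h⟩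
  have h1 := G.edist_map_le φ.symm (φ u) (φ v)
  simp only [RelIso.symm_apply_apply] at h1
  exact h1.trans h

theorem image_distBall (φ : G ≃g G) (u : V) (n : ℕ) :
    φ '' G.distBall u n = G.distBall (φ u) n := by
  ext v
  rw [← φ.apply_symm_apply v, φ.injective.mem_set_image, map_mem_distBall_iff]

variable (G) in
/-- The ball of radius `n` about `o` as a finset. -/
noncomputable def ballFinset [G.LocallyFinite] (o : V) (n : ℕ) : Finset V :=
  (G.distBall_finite o n).toFinset

@[simp]
theorem mem_ballFinset [G.LocallyFinite] {o v : V} {n : ℕ} :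
    v ∈ G.ballFinset o n ↔ v ∈ G.distBall o n := by
  simp [ballFinset]

theorem card_ballFinset [G.LocallyFinite] (o : V) (n : ℕ) :
    (G.ballFinset o n).card = G.ballVolume o n := by
  rw [ballVolume, ballFinset, Set.ncard_eq_toFinset_card _ (G.distBall_finite o n)]

theorem ballVolume_pos [G.LocallyFinite] (o : V) (n : ℕ) : 0 < G.ballVolume o n := by
  rw [← card_ballFinset]
  exact Finset.card_pos.2 ⟨o, mem_ballFinset.2 (G.self_mem_distBall o n)⟩

end Balls

/-! ### Overlap graph: packing bound and walk counting -/

section Overlap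

variable {V : Type*} (G : SimpleGraph V)

/-- The graph joining two distinct vertices when their balls of radius `n` have at least `c`
vertices in common. -/
def overlapGraph (n : ℕ) (c : ℝ) : SimpleGraph V where
  Adj v w := v ≠ w ∧ c ≤ ((G.distBall v n ∩ G.distBall w n).ncard : ℝ)
  symm := ⟨fun v w h => ⟨h.1.symm, by rw [Set.inter_comm]; exact h.2⟩⟩
  loopless := ⟨fun _ h => h.1 rfl⟩

variable {G}

/-- Automorphisms of a graph are automorphisms of its overlap graphs. -/
def overlapGraphIso (φ : G ≃g G) (n : ℕ) (c : ℝ) : G.overlapGraph n c ≃g G.overlapGraph n c where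
  toEquiv := φ.toEquiv
  map_rel_iff' {v w} := by
    change (φ v ≠ φ w ∧ c ≤ ((G.distBall (φ v) n ∩ G.distBall (φ w) n).ncard : ℝ)) ↔ _
    rw [← image_distBall, ← image_distBall, ← Set.image_inter φ.injective,
      Set.ncard_image_of_injective _ φ.injective, φ.injective.ne_iff]
    rfl

open Classical in
/-- Balls of radius `n` centred in `B(o, n)` whose pairwise intersections are smaller than `c`
are few in number. -/
theorem card_le_of_inter_lt [G.LocallyFinite] (hG : G.IsVertexTransitive) (o : V) {K : ℝ}
    (hK : 1 ≤ K) {n : ℕ}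
    (hd : (G.ballVolume o (2 * n) : ℝ) ≤ K * (G.ballVolume o n : ℝ)) {X : Finset V}
    (hX : X ⊆ G.ballFinset o n)
    (hsep : ∀ x ∈ X, ∀ y ∈ X, x ≠ y →
      ((G.distBall x n ∩ G.distBall y n).ncard : ℝ) < G.ballVolume o n / (2 * K)) :
    (X.card : ℝ) ≤ 2 * K := by
  set β : ℝ := (G.ballVolume o n : ℝ) with hβ
  have hβ0 : 0 < β := Nat.cast_pos.2 (ballVolume_pos o n)
  set B := G.ballFinset o (2 * n)
  have hsub : ∀ x ∈ X, G.ballFinset x n ⊆ B := fun x hx z hz => by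
    rw [mem_ballFinset] at *
    rw [two_mul]
    exact mem_distBall_add (mem_ballFinset.1 (hX hx)) hz
  have hcard : ∀ x ∈ X, ∑ z ∈ B, (if z ∈ G.ballFinset x n then (1 : ℝ) else 0) = β := by
    intro x hx
    rw [Finset.sum_ite_mem, Finset.inter_eq_right.2 (hsub x hx), Finset.sum_const, nsmul_one,
      card_ballFinset, hG.ballVolume_eq x o]
  have hfirst : ∑ z ∈ B, ∑ x ∈ X, (if z ∈ G.ballFinset x n then (1 : ℝ) else 0)
      = X.card * β := by
    rw [Finset.sum_comm, Finset.sum_congr rfl hcard, Finset.sum_const, nsmul_eq_mul]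
  have hsecond : ∑ z ∈ B, (∑ x ∈ X, (if z ∈ G.ballFinset x n then (1 : ℝ) else 0)) ^ 2
      ≤ X.card * (β + X.card * (β / (2 * K))) := by
    have h1 : ∑ z ∈ B, (∑ x ∈ X, (if z ∈ G.ballFinset x n then (1 : ℝ) else 0)) ^ 2
        = ∑ x ∈ X, ∑ y ∈ X, ∑ z ∈ B, (if z ∈ G.ballFinset x n then (1 : ℝ) else 0) *
          (if z ∈ G.ballFinset y n then (1 : ℝ) else 0) := by
      simp_rw [sq, Finset.sum_mul_sum]
      rw [Finset.sum_comm]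
      exact Finset.sum_congr rfl fun x _ => Finset.sum_comm
    rw [h1, ← nsmul_eq_mul]
    refine Finset.sum_le_card_nsmul _ _ _ fun x hx => ?_
    rw [← Finset.add_sum_erase _ _ hx]
    have hself : ∑ z ∈ B, (if z ∈ G.ballFinset x n then (1 : ℝ) else 0) *
        (if z ∈ G.ballFinset x n then (1 : ℝ) else 0) = β := by
      rw [← hcard x hx]
      exact Finset.sum_congr rfl fun z _ => by split_ifs <;> simp
    rw [hself]
    gcongr
    have h2 : ∀ y ∈ X.erase x, ∑ z ∈ B, (if z ∈ G.ballFinset x n then (1 : ℝ) else 0) *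
        (if z ∈ G.ballFinset y n then (1 : ℝ) else 0) ≤ β / (2 * K) := by
      intro y hy
      rw [Finset.mem_erase] at hy
      have h3 := hsep x hx y hy.2 hy.1.symm
      have h4 : (G.distBall x n ∩ G.distBall y n).ncard
          = (G.ballFinset x n ∩ G.ballFinset y n).card := by
        rw [← Set.ncard_coe_finset]
        congr 1
        ext z
        simp
      rw [h4] at h3
      refine le_trans (le_of_eq ?_) h3.le
      simp_rw [ite_zero_mul_ite_zero, mul_one, ← Finset.mem_inter]
      rw [Finset.sum_ite_mem, Finset.inter_eq_right.2
        (Finset.inter_subset_left.trans (hsub x hx)), Finset.sum_const, nsmul_one]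
    refine (Finset.sum_le_card_nsmul _ _ _ h2).trans ?_
    rw [nsmul_eq_mul]
    gcongr
    exact Finset.erase_subset _ _
  -- Cauchy–Schwarz for the number of balls covering z. The threshold β/(2K) yields |X|² ≤ K|X| +
  -- |X|²/2.
  have hcs := sq_sum_le_card_mul_sum_sq (s := B)
    (f := fun z => ∑ x ∈ X, (if z ∈ G.ballFinset x n then (1 : ℝ) else 0))
  rw [hfirst, card_ballFinset] at hcs
  have h5 : (X.card * β) ^ 2 ≤ (K * β) * (X.card * (β + X.card * (β / (2 * K)))) :=
    hcs.trans (mul_le_mul hd hsecond (Finset.sum_nonneg fun _ _ => sq_nonneg _) (by positivity))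
  have h6 : (K * β) * (X.card * (β + X.card * (β / (2 * K))))
      = β ^ 2 * (K * X.card + X.card ^ 2 / 2) := by
    field_simp
  rw [h6, mul_pow, mul_comm] at h5
  have h7 := le_of_mul_le_mul_left h5 (by positivity)
  rcases Nat.eq_zero_or_pos X.card with h0 | h0
  · rw [h0]
    push_cast
    linarith
  · have h0' : (0 : ℝ) < X.card := by exact_mod_cast h0
    refine le_of_mul_le_mul_left ?_ h0'
    nlinarith

/-- The number of walks `u = u₀, u₁, …, uᵢ` with steps of length at most `r` and last vertex
in `B(o, r)`. -/
noncomputable def jumpCount (G : SimpleGraph V) [G.LocallyFinite] (o : V) (r : ℕ) : ℕ → V → ℝ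
  | 0, u => (G.distBall o r).indicator 1 u
  | i + 1, u => ∑ w ∈ G.ballFinset u r, jumpCount G o r i w

theorem jumpCount_nonneg [G.LocallyFinite] (o : V) (r i : ℕ) (u : V) :
    0 ≤ G.jumpCount o r i u := by
  induction i generalizing u with
  | zero => exact Set.indicator_nonneg (fun _ _ => zero_le_one) u
  | succ i ih => exact Finset.sum_nonneg fun w _ => ih w

-- Reading walks backwards from their end in B(o, r), each of the i + 1 vertices has at most β(r)
-- choices.
open Classical in
theorem sum_jumpCount_le [G.LocallyFinite] (hG : G.IsVertexTransitive) (o : V) (r i : ℕ)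
    (s : Finset V) : ∑ u ∈ s, G.jumpCount o r i u ≤ (G.ballVolume o r : ℝ) ^ (i + 1) := by
  induction i generalizing s with
  | zero =>
    simp only [jumpCount, zero_add, pow_one, Set.indicator_apply, Pi.one_apply]
    rw [Finset.sum_boole, ← card_ballFinset]
    exact_mod_cast Finset.card_le_card fun u hu => by simpa using (Finset.mem_filter.1 hu).2
  | succ i ih =>
    simp only [jumpCount]
    rw [Finset.sum_comm' (t' := s.biUnion fun u => G.ballFinset u r)
      (s' := fun w => s ∩ G.ballFinset w r)]
    · rw [pow_succ']
      refine le_trans (Finset.sum_le_sum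
        (g := fun w => G.ballVolume o r * G.jumpCount o r i w) fun w _ => ?_) ?_
      · rw [Finset.sum_const, nsmul_eq_mul]
        refine mul_le_mul_of_nonneg_right ?_ (jumpCount_nonneg o r i w)
        rw [hG.ballVolume_eq o w, ← card_ballFinset]
        exact_mod_cast Finset.card_le_card Finset.inter_subset_right
      · rw [← Finset.mul_sum]
        exact mul_le_mul_of_nonneg_left (ih _) (Nat.cast_nonneg _)
    · intro u w
      simp only [Finset.mem_biUnion, Finset.mem_inter, mem_ballFinset]
      rw [mem_distBall_comm (u := w)]
      exact ⟨fun h => ⟨h, u, h.1, mem_distBall_comm.1 h.2⟩, fun h => h.1⟩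

/-- Along an F-path from w to v, pick a point in each overlap of consecutive `n`-balls: at least c
choices each time. Successive picks share an `n`-ball, so they are 2n-close. -/
theorem pow_le_jumpCount [G.LocallyFinite] {o v w : V} {n i : ℕ} {c : ℝ} (hc : 0 ≤ c)
    (hcv : ∀ v, c ≤ G.ballVolume v n) (hv : v ∈ G.distBall o n)
    (hw : w ∈ (G.overlapGraph n c).distBall v i) {u : V} (hu : u ∈ G.distBall w n) :
    c ^ i ≤ G.jumpCount o (2 * n) i u := by
  induction i generalizing w u with
  | zero =>
    have hvw : w = v := by simpa [distBall, eq_comm (a := v)] using hw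
    subst hvw
    have : u ∈ G.distBall o (2 * n) := two_mul n ▸ mem_distBall_add hv hu
    simp [jumpCount, this]
  | succ i ih =>
    obtain ⟨x, hx, hxw⟩ := exists_mem_distBall_of_add hw
    have hov : c ≤ ((G.distBall x n ∩ G.distBall w n).ncard : ℝ) := by
      by_cases hxw' : x = w
      · rw [hxw', Set.inter_self]
        exact hcv w
      · obtain ⟨p, hp⟩ := mem_distBall_iff_exists_walk.1 hxw
        cases p with
        | nil => exact absurd rfl hxw'
        | cons h q =>
          cases q with
          | nil => exact h.2
          | cons h' q =>
            simp only [Walk.length_cons] at hp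
            omega
    have hfin : (G.distBall x n ∩ G.distBall w n).Finite :=
      (G.distBall_finite x n).subset Set.inter_subset_left
    rw [Set.ncard_eq_toFinset_card _ hfin] at hov
    simp only [jumpCount]
    rw [pow_succ']
    have hsub : hfin.toFinset ⊆ G.ballFinset u (2 * n) := fun z hz => by
      rw [Set.Finite.mem_toFinset] at hz
      rw [mem_ballFinset, two_mul]
      exact mem_distBall_add (mem_distBall_comm.1 hu) hz.2
    calc c * c ^ i ≤ hfin.toFinset.card * c ^ i := by gcongr
      _ = ∑ z ∈ hfin.toFinset, c ^ i := by rw [Finset.sum_const, nsmul_eq_mul]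
      _ ≤ ∑ z ∈ hfin.toFinset, G.jumpCount o (2 * n) i z :=
        Finset.sum_le_sum fun z hz => ih hx ((Set.Finite.mem_toFinset _).1 hz).1
      _ ≤ _ := Finset.sum_le_sum_of_subset_of_nonneg hsub fun z _ _ => jumpCount_nonneg _ _ _ _

/-- A finite set lying within overlap distance `M` of a ball of radius `n` is small. -/
theorem card_mul_pow_le [G.LocallyFinite] (hG : G.IsVertexTransitive) {o : V} {n M : ℕ} {c : ℝ}
    (hc : 0 ≤ c) (hcv : c ≤ G.ballVolume o n) {s : Finset V}
    (hs : ∀ w ∈ s, ∃ v ∈ G.distBall o n, w ∈ (G.overlapGraph n c).distBall v M) :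
    s.card * c ^ M ≤ (G.ballVolume o (2 * n) : ℝ) ^ (M + 1) := by
  refine le_trans ?_ (sum_jumpCount_le hG o (2 * n) M s)
  rw [← nsmul_eq_mul]
  refine Finset.card_nsmul_le_sum _ _ _ fun w hw => ?_
  obtain ⟨v, hv, hvw⟩ := hs w hw
  exact pow_le_jumpCount hc (fun v => by rwa [hG.ballVolume_eq v o]) hv hvw
    (G.self_mem_distBall w n)

end Overlap

/-! ### Nets and stationary chains -/

section Nets

variable {V : Type*} {F : SimpleGraph V}

open Classical in
/-- If `1`-separated subsets of `B` have at most `J` elements, then at some scale `5 ^ j` with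
`j < J` there is a covering subset that is separated at the next scale. -/
theorem exists_separated_net {B : Finset V} {o : V} (ho : o ∈ B) {J : ℕ}
    (hJ : ∀ X ⊆ B, (∀ x ∈ X, ∀ y ∈ X, x ≠ y → y ∉ F.distBall x 1) → X.card ≤ J) :
    ∃ j < J, ∃ X ⊆ B, (∀ x ∈ X, ∀ y ∈ X, x ≠ y → y ∉ F.distBall x (5 * 5 ^ j)) ∧
      ∀ y ∈ B, ∃ x ∈ X, y ∈ F.distBall x (5 ^ j) := by
  by_contra! hcon
  -- Going down from scale 5^J, each failure to cover supplies a new point at the cost of a factor 5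
  -- in separation. J failures leave J + 1 points that are 1-separated.
  have key : ∀ t ≤ J, ∃ X ⊆ B,
      (∀ x ∈ X, ∀ y ∈ X, x ≠ y → y ∉ F.distBall x (5 ^ (J - t))) ∧ X.card = t + 1 := by
    intro t
    induction t with
    | zero =>
      refine fun _ => ⟨{o}, by simpa using ho, fun x hx y hy h => ?_, by simp⟩
      rw [Finset.mem_singleton] at hx hy
      exact absurd (hx.trans hy.symm) h
    | succ t ih =>
      intro ht
      obtain ⟨X, hXB, hX, hcard⟩ := ih (by omega)
      have hst : J - t = J - (t + 1) + 1 := by omega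
      rw [hst, pow_succ'] at hX
      obtain ⟨y, hyB, hy⟩ := hcon (J - (t + 1)) (by omega) X hXB hX
      have hyX : y ∉ X := fun h => hy y h (F.self_mem_distBall _ _)
      refine ⟨insert y X, Finset.insert_subset hyB hXB, ?_, by
        rw [Finset.card_insert_of_notMem hyX, hcard]⟩
      intro a ha b hb hab
      rw [Finset.mem_insert] at ha hb
      rcases ha with rfl | ha <;> rcases hb with rfl | hb
      · exact absurd rfl hab
      · exact fun h => hy b hb (mem_distBall_comm.1 h)
      · exact hy a ha
      · exact fun h => hX a ha b hb hab (distBall_mono a (Nat.le_mul_of_pos_left _ (by omega)) h)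
  obtain ⟨X, hXB, hX, hcard⟩ := key J le_rfl
  rw [Nat.sub_self, pow_zero] at hX
  have := hJ X hXB hX
  omega

/-- A monotone sequence of finsets contained in a nonempty finset is stationary at some step. -/
theorem exists_eq_succ_of_monotone {α : Type*} {X : Finset α} {f : ℕ → Finset α}
    (hf : Monotone f) (h0 : (f 0).Nonempty) (hX : ∀ k ≤ X.card, f k ⊆ X) :
    ∃ k < X.card, f (k + 1) = f k := by
  by_contra! hcon
  have key : ∀ k ≤ X.card, k + 1 ≤ (f k).card := by
    intro k
    induction k with
    | zero => exact fun _ => Finset.card_pos.2 h0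
    | succ k ih =>
      intro hk
      have h1 := ih (by omega)
      have h2 := Finset.card_lt_card
        ((hf (by omega : k ≤ k + 1)).ssubset_of_ne (hcon k (by omega)).symm)
      omega
  have h1 := key _ le_rfl
  have h2 := Finset.card_le_card (hX _ le_rfl)
  omega

end Nets

/-! ### From a small ball to large balls -/

section Propagation

variable {V : Type*} {G F : SimpleGraph V}

open Classical in
/-- If a net `X` covers `B(o, n)` at scale `m` in `F`, is separated at scale `5 m`, and has at
most `n` points, then `B(o, n)` lies within `F`-distance `2 m` of a ball of small radius. -/
theorem exists_small_radius [G.LocallyFinite] (hG : G.IsVertexTransitive)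
    (hF : ∀ (φ : G ≃g G) (u v : V), F.edist (φ u) (φ v) ≤ F.edist u v) {o : V} {n m : ℕ}
    {X : Finset V} (hXn : X.card ≤ n)
    (hsep : ∀ x ∈ X, ∀ y ∈ X, x ≠ y → y ∉ F.distBall x (5 * m))
    (hcov : ∀ y ∈ G.distBall o n, ∃ x ∈ X, y ∈ F.distBall x m) :
    ∃ k < X.card, ∀ (p : V), ∀ v ∈ G.distBall p n,
      ∃ w ∈ G.distBall p k, v ∈ F.distBall w (2 * m) := by
  choose! π hπX hπ using hcov
  -- Distinct net points would be within m + 2m + m < 5m + 1 of each other.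
  have hclass : ∀ y ∈ G.distBall o n, ∀ z ∈ G.distBall o n, z ∈ F.distBall y (2 * m) →
      π y = π z := by
    intro y hy z hz hyz
    by_contra hne
    refine hsep _ (hπX y hy) _ (hπX z hz) hne ?_
    have h := mem_distBall_add (mem_distBall_add (hπ y hy) hyz) (mem_distBall_comm.1 (hπ z hz))
    exact distBall_mono _ (by omega) h
  obtain ⟨k, hk, hkk⟩ := exists_eq_succ_of_monotone (X := X)
    (f := fun k => (G.ballFinset o k).image π)
    (fun a b hab => Finset.image_subset_image fun z hz => by
      rw [mem_ballFinset] at *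
      exact distBall_mono o hab hz)
    ⟨π o, Finset.mem_image_of_mem π (mem_ballFinset.2 (G.self_mem_distBall o 0))⟩
    (fun k hk y hy => by
      obtain ⟨z, hz, rfl⟩ := Finset.mem_image.1 hy
      exact hπX z (distBall_mono o (hk.trans hXn) (mem_ballFinset.1 hz)))
  have hstep : ∀ v ∈ G.distBall o (k + 1), ∃ w ∈ G.distBall o k, π w = π v := by
    intro v hv
    have h1 : π v ∈ (G.ballFinset o (k + 1)).image π :=
      Finset.mem_image_of_mem π (mem_ballFinset.2 hv)
    rw [hkk] at h1
    obtain ⟨w, hw, hwv⟩ := Finset.mem_image.1 h1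
    exact ⟨w, mem_ballFinset.1 hw, hwv⟩
  have hlift : ∀ {i : ℕ}, (∀ v ∈ G.distBall o i, ∃ w ∈ G.distBall o k, v ∈ F.distBall w (2 * m)) →
      ∀ p, ∀ v ∈ G.distBall p i, ∃ w ∈ G.distBall p k, v ∈ F.distBall w (2 * m) := by
    intro i h p v hv
    obtain ⟨φ, rfl⟩ := hG o p
    rw [← φ.apply_symm_apply v, map_mem_distBall_iff] at hv
    obtain ⟨w, hw, hvw⟩ := h _ hv
    refine ⟨φ w, (map_mem_distBall_iff φ).2 hw, ?_⟩
    have := (hF φ w (φ.symm v)).trans hvw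
    rwa [φ.apply_symm_apply] at this
  -- The error stays 2m along the induction: w in B(o, k + 1) is exchanged for w' in B(o, k) with
  -- the same net point, which is also that of v.
  have hmain : ∀ i ≤ n, ∀ v ∈ G.distBall o i,
      ∃ w ∈ G.distBall o k, v ∈ F.distBall w (2 * m) := by
    intro i
    induction i with
    | zero =>
      exact fun _ v hv => ⟨v, distBall_mono o k.zero_le hv, F.self_mem_distBall _ _⟩
    | succ i ih =>
      intro hi v hv
      have hvn := distBall_mono o hi hv
      rw [add_comm] at hv
      obtain ⟨p, hp, hpv⟩ := exists_mem_distBall_of_add hv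
      obtain ⟨w, hw, hvw⟩ := hlift (ih (by omega)) p v hpv
      have hw' : w ∈ G.distBall o (k + 1) := add_comm 1 k ▸ mem_distBall_add hp hw
      obtain ⟨w', hw'k, hπw⟩ := hstep w hw'
      have hwn := distBall_mono o (by omega : k + 1 ≤ n) hw'
      have hwn' := distBall_mono o (by omega : k ≤ n) hw'k
      refine ⟨w', hw'k, two_mul m ▸ mem_distBall_add (mem_distBall_comm.1 (hπ w' hwn')) ?_⟩
      rw [hπw, hclass w hwn v hvn hvw]
      exact hπ v hvn
  exact ⟨k, hk, hlift (hmain n le_rfl)⟩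

/-- Covering of balls of radius `n` by `F`-neighbourhoods of balls of radius `k` propagates to
balls of larger radius. -/
theorem exists_mem_distBall_of_cover {n k m : ℕ} (hkn : k ≤ n)
    (h : ∀ (p : V), ∀ v ∈ G.distBall p n, ∃ w ∈ G.distBall p k, v ∈ F.distBall w m) (o : V)
    (j : ℕ) {v : V} (hv : v ∈ G.distBall o (n + j * (n - k))) :
    ∃ w ∈ G.distBall o k, v ∈ F.distBall w ((j + 1) * m) := by
  induction j generalizing v with
  | zero => simpa using h o v (by simpa using hv)
  | succ j ih =>
    have harith : n + (j + 1) * (n - k) = (j + 1) * (n - k) + n := by ring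
    rw [harith] at hv
    obtain ⟨p, hp, hpv⟩ := exists_mem_distBall_of_add hv
    obtain ⟨w, hw, hvw⟩ := h p v hpv
    have hw' : w ∈ G.distBall o (n + j * (n - k)) := by
      refine distBall_mono o ?_ (mem_distBall_add hp hw)
      rw [add_mul]
      omega
    obtain ⟨w', hw', hww⟩ := ih hw'
    exact ⟨w', hw', by rw [add_mul _ 1, one_mul]; exact mem_distBall_add hww hvw⟩

end Propagation

/-- Doubling at scale `n` bounds tripling at scale `n`, with explicit exponent. -/
theorem ballVolume_three_mul_le {V : Type*} {G : SimpleGraph V} [G.LocallyFinite]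
    (hG : G.IsVertexTransitive) (o : V) {K : ℝ} (hK : 1 ≤ K) {n : ℕ} (hn : 4 * K ≤ n)
    (hd : (G.ballVolume o (2 * n) : ℝ) ≤ K * (G.ballVolume o n : ℝ)) :
    ∃ j : ℕ, (j : ℝ) ≤ 2 * K ∧
      (G.ballVolume o (3 * n) : ℝ) ≤
        (2 * K ^ 2) ^ (10 * 5 ^ j) * K * (G.ballVolume o n : ℝ) := by
  set β : ℝ := (G.ballVolume o n : ℝ) with hβ
  have hβ0 : 0 < β := Nat.cast_pos.2 (ballVolume_pos o n)
  have hK0 : 0 < K := by linarith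
  set c : ℝ := β / (2 * K) with hc
  have hc0 : 0 < c := by positivity
  have hcβ : c ≤ β := div_le_self hβ0.le (by linarith)
  set F := G.overlapGraph n c
  have hfew : ∀ X ⊆ G.ballFinset o n, (∀ x ∈ X, ∀ y ∈ X, x ≠ y → y ∉ F.distBall x 1) →
      X.card ≤ ⌊2 * K⌋₊ := by
    intro X hX hsep
    refine Nat.le_floor (card_le_of_inter_lt hG o hK hd hX fun x hx y hy hxy => ?_)
    by_contra! hle
    refine hsep x hx y hy hxy (mem_distBall_iff_exists_walk.2 ⟨Walk.cons (v := y) ?_ .nil, ?_⟩)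
    · exact ⟨hxy, hle⟩
    · exact le_rfl
  obtain ⟨j, hj, X, hXB, hsep, hcov⟩ :=
    exists_separated_net (mem_ballFinset.2 (G.self_mem_distBall o n)) hfew
  have hXK : X.card ≤ ⌊2 * K⌋₊ := hfew X hXB fun x hx y hy hxy h =>
    hsep x hx y hy hxy (distBall_mono x (Nat.succ_le_of_lt (by positivity)) h)
  have hfloor : (⌊2 * K⌋₊ : ℝ) ≤ 2 * K := Nat.floor_le (by positivity)
  have hXn : 2 * X.card ≤ n := by
    have h1 : (X.card : ℝ) ≤ ⌊2 * K⌋₊ := by exact_mod_cast hXK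
    have h2 : ((2 * X.card : ℕ) : ℝ) ≤ n := by
      push_cast
      linarith
    exact_mod_cast h2
  obtain ⟨k, hk, hcover⟩ := exists_small_radius hG
    (fun φ u v => F.edist_map_le (overlapGraphIso φ n c) u v) (by omega) hsep
    (fun y hy => hcov y (mem_ballFinset.2 hy))
  refine ⟨j, le_trans (by exact_mod_cast hj.le) hfloor, ?_⟩
  have hs : ∀ w ∈ G.ballFinset o (3 * n),
      ∃ v ∈ G.distBall o n, w ∈ F.distBall v (10 * 5 ^ j) := by
    intro w hw
    -- Four iterations suffice: n + 4(n - k) ≥ 3n because 2k ≤ n. The F-distance is 5 · 2 · 5^j.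
    obtain ⟨v, hv, hvw⟩ := exists_mem_distBall_of_cover (by omega : k ≤ n) hcover o 4
      (distBall_mono o (by omega) (mem_ballFinset.1 hw))
    exact ⟨v, distBall_mono o (by omega) hv, distBall_mono v (by omega) hvw⟩
  have hcount := card_mul_pow_le hG hc0.le hcβ hs
  rw [card_ballFinset] at hcount
  set M := 10 * 5 ^ j
  have h1 : (G.ballVolume o (3 * n) : ℝ) * c ^ M ≤ (K * β) ^ (M + 1) :=
    hcount.trans (by gcongr)
  refine le_of_mul_le_mul_right (h1.trans (le_of_eq ?_)) (pow_pos hc0 M)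
  have h2 : K * β = 2 * K ^ 2 * c := by
    rw [hc]
    field_simp
  rw [pow_succ]
  conv_lhs => rw [h2, mul_pow, ← h2]
  ring

end SimpleGraph

theorem mainTheorem3 {V : Type*} (G : SimpleGraph V) [G.LocallyFinite]
    (hG : G.IsVertexTransitive) (o : V) (K : ℝ) (hK : 1 ≤ K) (n : ℕ)
    (hn : 8 * K ^ 4 ≤ (n : ℝ))
    (hdoubling : (G.ballVolume o (2 * n) : ℝ) ≤ K * (G.ballVolume o n : ℝ)) :
    (G.ballVolume o (3 * n) : ℝ) ≤
      ((2 : ℝ) ^ 12 * K ^ 24) ^ ((10 : ℝ) * (5 : ℝ) ^ ((4 : ℝ) * K ^ 4)) *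
        (G.ballVolume o n : ℝ) := by
  have hK4 : K ≤ K ^ 4 := le_self_pow₀ hK (by norm_num)
  obtain ⟨j, hj, hle⟩ := SimpleGraph.ballVolume_three_mul_le hG o hK (by linarith) hdoubling
  refine hle.trans (mul_le_mul_of_nonneg_right ?_ (Nat.cast_nonneg _))
  have hb : (1 : ℝ) ≤ 2 * K ^ 2 := by nlinarith
  set a : ℝ := (10 : ℝ) * (5 : ℝ) ^ ((4 : ℝ) * K ^ 4) with ha
  have hMa : ((10 * 5 ^ j : ℕ) : ℝ) ≤ a := by
    push_cast
    rw [ha, ← Real.rpow_natCast]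
    gcongr
    · norm_num
    · linarith
  have ha1 : 1 ≤ a := by
    refine le_trans ?_ hMa
    exact_mod_cast Nat.succ_le_of_lt (by positivity)
  have hbase : (2 : ℝ) ^ 12 * K ^ 24 = (2 * K ^ 2) ^ (12 : ℝ) := by
    rw [show (12 : ℝ) = (12 : ℕ) by norm_num, Real.rpow_natCast]
    ring
  rw [hbase, ← Real.rpow_mul (by positivity), ← Real.rpow_natCast]
  calc (2 * K ^ 2) ^ ((10 * 5 ^ j : ℕ) : ℝ) * K
      ≤ (2 * K ^ 2) ^ a * (2 * K ^ 2) ^ (1 : ℝ) := by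
        rw [Real.rpow_one]
        gcongr
        nlinarith
    _ = (2 * K ^ 2) ^ (a + 1) := (Real.rpow_add (by positivity) _ _).symm
    _ ≤ (2 * K ^ 2) ^ (12 * a) := Real.rpow_le_rpow_of_exponent_le hb (by linarith)
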